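/- Write $(M)_{ij}$ for the entry of a matrix $M$ in column $i$ and row $j$, and $\|M\|=\max_{i,j}|(M)_{ij}|$. For an $N$-dimensional mixed state $\rho$ (a positive semidefinite complex $N\times N$ matrix of trace $1$) and a unitary $N\times N$ matrix $U$, let $F(\rho,U)$ be the set of real arrays $(f_{ij})_{1\le i,j\le N}$ with $0\le f_{ij}\le |(U)_{ij}|$ for all $i,j$, $\sum_j f_{ij}=(\rho)_{ii}$ for all $i$, and $\sum_i f_{ij}=(U\rho U^{-1})_{jj}$ for all $j$. Let $f^*(\rho,U)\in F(\rho,U)$ be the lexicographically maximal element: going through the pairs $(i,j)$ in lexicographic order, each $f^*_{ij}$ is the maximum of $f_{ij}$ over all $f\in F(\rho,U)$ that agree with $f^*$ at all earlier pairs. The flow theory $\mathcal{FT}$ has the joint-probability matrices $$P(\rho,U)=\frac1{N!}\sum_Q Q\,f^*(Q^{-1}\rho Q,\,Q^{-1}UQ)\,Q^{-1},$$ where $Q$ ranges over all $N\times N$ permutation matrices. Theorem. (a) Let $G$ be a finite directed network with source $s$, sink $t\ne s$, edges $e_1,\dots,e_m$ and capacities $c_1,\dots,c_m\ge 0$, and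 add an edge $e_0$ from $t$ to $s$ of unlimited capacity, so that flows in $G$ become circulations. Then there is exactly one circulation $f^*$ that first maximizes the flow $f_0$ through $e_0$, then the flow $f_1$ through $e_1$ with $f_0$ held fixed, and so on up to $f_m$. If a single capacity of $G$ is changed by $\varepsilon$ (increased or decreased, remaining nonnegative), then every coordinate $f^*_0,f^*_1,\dots,f^*_m$ changes by at most $|\varepsilon|$. (b) For every $N\ge1$, every $N$-dimensional mixed state $\rho$ and every $N\times N$ unitary $U$, the flow $f^*(\rho,U)$ exists; in particular $F(\rho,U)$ is nonempty. (c) $\mathcal{FT}$ is robust: for every real polynomial $p$ that is positive at all integers $N\ge1$ there is a real polynomial $q$, positive at all integers $N\ge1$, such that for all $N\ge1$, all $N$-dimensional mixed states $\rho,\widetilde\rho$ and all $N\times N$ unitaries $U,\widetilde U$ with $\|\widetilde\rho-\rho\|\le 1/q(N)$ and $\|\widetilde U-U\|\le 1/q(N)$, $$\|P(\widetilde\rho,\widetilde U)-P(\rho,U)\|\le \frac1{p(N)}.$$ -/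

import Mathlib

open scoped Matrix ComplexOrder Matrix.Norms.Elementwise

noncomputable section

/-! ### Lexicographic maximization -/

/-- `f` is the lexicographic maximum of `S`: `f ∈ S`, and for every index `k` the coordinate `f k` is
the largest value of `g k` over all `g ∈ S` that agree with `f` on all earlier indices. -/
def IsLexMax {ι : Type*} [LinearOrder ι] (S : Set (ι → ℝ)) (f : ι → ℝ) : Prop :=
  f ∈ S ∧ ∀ k : ι, ∀ g ∈ S, (∀ l < k, g l = f l) → g k ≤ f k

open Classical in
/-- The lexicographic maximum of `S` (with the value `0` if there is none). -/
def lexMax {ι : Type*} [LinearOrder ι] (S : Set (ι → ℝ)) : ι → ℝ :=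
  if h : ∃ f, IsLexMax S f then h.choose else 0

/-! ### Flow networks -/

/-- A directed multigraph with vertices `V`, edges `E` and two distinct vertices, the source and the
sink. The edge `e` leads from `tail e` to `head e`. -/
structure FlowNetwork (V E : Type*) where
  source : V
  sink : V
  source_ne_sink : source ≠ sink
  tail : E → V
  head : E → V

namespace FlowNetwork

variable {V E : Type*}

/-- The tails of the edges, including the fictitious edge `⊥` from the sink to the source. -/
def extTail (G : FlowNetwork V E) : WithBot E → V :=
  WithBot.recBotCoe G.sink G.tail

/-- The heads of the edges, including the fictitious edge `⊥` from the sink to the source. -/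
def extHead (G : FlowNetwork V E) : WithBot E → V :=
  WithBot.recBotCoe G.source G.head

/-- The flows of the network `G` with edge capacities `c`, closed up by the fictitious edge `⊥` from
the sink to the source, which has unlimited capacity: at every vertex the outgoing flow equals the
incoming flow. The coordinate `f ⊥` is the amount of flow from the source to the sink. -/
def flows [Fintype E] [DecidableEq V] (G : FlowNetwork V E) (c : E → ℝ) :
    Set (WithBot E → ℝ) :=
  {f | (∀ e, 0 ≤ f e) ∧ (∀ e : E, f (e : WithBot E) ≤ c e) ∧
    ∀ v : V, (∑ e, if G.extTail e = v then f e else 0) = ∑ e, if G.extHead e = v then f e else 0}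

end FlowNetwork

/-! ### States, and the flow theory -/

/-- `ρ` is an `N`-dimensional mixed state. -/
def IsMixedState {N : ℕ} (ρ : Matrix (Fin N) (Fin N) ℂ) : Prop :=
  ρ.PosSemidef ∧ ρ.trace = 1

namespace FlowTheory

variable {N : ℕ}

/-- The maximum flows `F(ρ, U)`. The coordinate `f (toLex (i, j))` is the flow from the basis state
`i` to the basis state `j`; the capacity of that edge is the modulus of the amplitude with which `U`
takes `i` to `j`, which is the entry of `U` in column `i` and row `j`. The index pairs `(i, j)` are
ordered lexicographically. For a unitary `U` one has `Uᴴ = U⁻¹`. -/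
def maxFlows (ρ U : Matrix (Fin N) (Fin N) ℂ) : Set (Fin N ×ₗ Fin N → ℝ) :=
  {f | (∀ i j, 0 ≤ f (toLex (i, j)) ∧ f (toLex (i, j)) ≤ ‖U j i‖) ∧
    (∀ i, ∑ j, f (toLex (i, j)) = (ρ i i).re) ∧
    (∀ j, ∑ i, f (toLex (i, j)) = ((U * ρ * Uᴴ) j j).re)}

/-- The lexicographically maximal flow `f*(ρ, U)` as a matrix; the flow from `i` to `j` is the entry
in column `i` and row `j`. -/
def lexMaxFlow (ρ U : Matrix (Fin N) (Fin N) ℂ) : Matrix (Fin N) (Fin N) ℝ :=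
  Matrix.of fun j i => lexMax (maxFlows ρ U) (toLex (i, j))

/-- The joint probabilities matrix of the flow theory,
`P(ρ, U) = (1 / N!) ∑_Q Q f*(Q⁻¹ ρ Q, Q⁻¹ U Q) Q⁻¹`, where `Q` ranges over the permutation matrices. -/
def joint (N : ℕ) (ρ U : Matrix (Fin N) (Fin N) ℂ) : Matrix (Fin N) (Fin N) ℝ :=
  (1 / (Nat.factorial N : ℝ)) • ∑ σ : Equiv.Perm (Fin N),
    σ.permMatrix ℝ *
      lexMaxFlow ((σ.permMatrix ℂ)⁻¹ * ρ * σ.permMatrix ℂ)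
        ((σ.permMatrix ℂ)⁻¹ * U * σ.permMatrix ℂ) *
      (σ.permMatrix ℝ)⁻¹

end FlowTheory

/-- Robustness of a hidden-variable theory with joint probabilities matrices `P N ρ U`. The norm of a
matrix is the maximum modulus of its entries. A bound `1 / p(N)` or `1 / q(N)` is meant for
polynomials that are positive at all `N ≥ 1`. -/
def IsRobust
    (P : ∀ N : ℕ, Matrix (Fin N) (Fin N) ℂ → Matrix (Fin N) (Fin N) ℂ →
      Matrix (Fin N) (Fin N) ℝ) : Prop :=
  ∀ p : Polynomial ℝ, (∀ N : ℕ, 1 ≤ N → 0 < p.eval (N : ℝ)) →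
    ∃ q : Polynomial ℝ, (∀ N : ℕ, 1 ≤ N → 0 < q.eval (N : ℝ)) ∧
      ∀ N : ℕ, 1 ≤ N → ∀ ρ ρ' U U' : Matrix (Fin N) (Fin N) ℂ,
        IsMixedState ρ → IsMixedState ρ' →
        U ∈ Matrix.unitaryGroup (Fin N) ℂ → U' ∈ Matrix.unitaryGroup (Fin N) ℂ →
        ‖ρ' - ρ‖ ≤ 1 / q.eval (N : ℝ) → ‖U' - U‖ ≤ 1 / q.eval (N : ℝ) →
        ‖P N ρ' U' - P N ρ U‖ ≤ 1 / p.eval (N : ℝ)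

end

/-! ### Lexicographic maxima -/

/-! Part (a) is an exchange argument. Suppose the capacity of `a` grows, and let `d = f' - f` be the
difference of the new and old lexicographic maxima, a circulation. A circulation `z` that has the
signs of `d` and avoids `a` can be added to `f` and subtracted from `f'` in a small amount. Hence
its first nonzero coordinate would be neither positive nor negative, and `z = 0`
(`eq_zero_of_isLexMax`). So all flow of `d` runs in cycles through `a`, and `d a` bounds every
coordinate (`abs_le_of_no_cycle`). If `f` saturates `a`, then `d a` is at most the increase of the
capacity; if it does not, or if `d a ≤ 0`, the same exchange applied to `d` itself gives `d = 0`.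

For (b), `F(ρ, U)` is the set of plans of a transportation network whose supplies and demands total
1. By max-flow min-cut it suffices that every cut has capacity at least 1. This is an uncertainty
relation: the projections onto the coordinates `A`, and onto those that `U` carries to the
coordinates `B`, have overlap at most `∑ |U j i|` over `A × B` (`IsMixedState.cut_le`). The edges at
the source and the sink precede the middle edges and are saturated, so the lexicographically maximal
flow restricts to `f*(ρ, U)`.

For (c), (a) is applied to one capacity at a time. The capacities are Lipschitz in `(ρ, U)` with
polynomial constants, and averaging over permutations does not worsen the bound. -/

theorem IsLexMax.eq {ι : Type*} [LinearOrder ι] [Finite ι] {S : Set (ι → ℝ)} {f g : ι → ℝ}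
    (hf : IsLexMax S f) (hg : IsLexMax S g) : f = g := by
  funext k
  induction k using WellFoundedLT.induction with
  | ind k ih =>
    exact le_antisymm (hg.2 k f hf.1 fun l hl => ih l hl) (hf.2 k g hg.1 fun l hl => (ih l hl).symm)

theorem IsLexMax.lexMax_eq {ι : Type*} [LinearOrder ι] [Finite ι] {S : Set (ι → ℝ)} {f : ι → ℝ}
    (hf : IsLexMax S f) : lexMax S = f := by
  have h : ∃ f, IsLexMax S f := ⟨f, hf⟩
  rw [lexMax, dif_pos h]
  exact h.choose_spec.eq hf

theorem IsCompact.exists_isLexMax {ι : Type*} [LinearOrder ι] [Fintype ι] {S : Set (ι → ℝ)}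
    (hS : IsCompact S) (hne : S.Nonempty) : ∃ f, IsLexMax S f := by
  have key : ∀ s : Finset ι, ∃ f ∈ S, ∀ k ∈ s, ∀ g ∈ S,
      (∀ l ∈ s, l < k → g l = f l) → g k ≤ f k := by
    intro s
    induction s using Finset.induction_on_max with
    | empty => exact ⟨hne.some, hne.some_mem, by simp⟩
    | insert a s has ih =>
      obtain ⟨f, hfS, hf⟩ := ih
      have hcl : IsClosed {g : ι → ℝ | ∀ l ∈ s, g l = f l} := by
        simp only [Set.ofPred_forall]
        exact isClosed_iInter fun l => isClosed_iInter fun _ =>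
          isClosed_eq (continuous_apply l) continuous_const
      -- The new index `a` lies above all of `s`, so maximizing it among the points that agree with
      -- `f` on `s` spoils nothing already achieved.
      obtain ⟨f', ⟨hS', hag⟩, hmax⟩ := (hS.inter_right hcl).exists_isMaxOn
        ⟨f, hfS, fun _ _ => rfl⟩ (continuous_apply a).continuousOn
      refine ⟨f', hS', fun k hk g hg hgk => ?_⟩
      rcases Finset.mem_insert.1 hk with rfl | hk
      · exact hmax ⟨hg, fun l hl =>
          (hgk l (Finset.mem_insert_of_mem hl) (has l hl)).trans (hag l hl)⟩
      · rw [hag k hk]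
        exact hf k hk g hg fun l hl hlk =>
          (hgk l (Finset.mem_insert_of_mem hl) hlk).trans (hag l hl)
  obtain ⟨f, hfS, hf⟩ := key Finset.univ
  exact ⟨f, hfS, fun k g hg h => hf k (Finset.mem_univ k) g hg fun l _ hl => h l hl⟩

/-- Moving from a lexicographic maximum within `S`, the first coordinate to change decreases. -/
theorem IsLexMax.direction_nonpos {ι : Type*} [LinearOrder ι] {S : Set (ι → ℝ)} {f z : ι → ℝ}
    (hf : IsLexMax S f) (hz : ∃ δ : ℝ, 0 < δ ∧ f + δ • z ∈ S) {k : ι} (hk : ∀ l < k, z l = 0) :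
    z k ≤ 0 := by
  obtain ⟨δ, hδ, hmem⟩ := hz
  have := hf.2 k _ hmem fun l hl => by simp [hk l hl]
  simp only [Pi.add_apply, Pi.smul_apply, smul_eq_mul] at this
  by_contra! h
  nlinarith [mul_pos hδ h]

/-! ### Circulations -/

section Circulation

variable {V F : Type*} [DecidableEq V] [Fintype F]

/-- The net flow of `z` out of the vertex `v`. -/
def netOut (t h : F → V) (z : F → ℝ) (v : V) : ℝ :=
  (∑ e, if t e = v then z e else 0) - ∑ e, if h e = v then z e else 0

theorem netOut_add (t h : F → V) (y z : F → ℝ) (v : V) :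
    netOut t h (y + z) v = netOut t h y v + netOut t h z v := by
  have : ∀ (P : F → Prop) [DecidablePred P], (∑ e, if P e then (y + z) e else 0) =
      (∑ e, if P e then y e else 0) + ∑ e, if P e then z e else 0 := by
    intro P _
    rw [← Finset.sum_add_distrib]
    refine Finset.sum_congr rfl fun e _ => ?_
    split_ifs <;> simp
  simp only [netOut, this]
  ring

theorem netOut_smul (t h : F → V) (a : ℝ) (z : F → ℝ) (v : V) :
    netOut t h (a • z) v = a * netOut t h z v := by
  simp [netOut, mul_sub, Finset.mul_sum]

theorem netOut_single [DecidableEq F] (t h : F → V) (e : F) (a : ℝ) (v : V) :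
    netOut t h (Pi.single e a) v =
      (if t e = v then a else 0) - if h e = v then a else 0 := by
  have : ∀ (P : F → Prop) [DecidablePred P],
      (∑ x, if P x then (Pi.single e a : F → ℝ) x else 0) = if P e then a else 0 := by
    intro P _
    rw [Finset.sum_eq_single e]
    · simp
    · intro b _ hb
      simp [hb]
    · simp
  simp only [netOut, this]

open Classical in
/-- The net flow of a circulation out of any set of vertices vanishes. -/
theorem sum_cut_eq_zero {t h : F → V} {z : F → ℝ} (hz : ∀ v, netOut t h z v = 0) (R : Set V) :
    ∑ e, z e * ((if t e ∈ R then 1 else 0) - if h e ∈ R then 1 else 0) = 0 := by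
  -- `V` may be infinite; only the endpoints of edges contribute.
  set T : Finset V := (Finset.univ.image t ∪ Finset.univ.image h).filter (· ∈ R)
  have key : ∀ u : F → V, (∀ e, u e ∈ Finset.univ.image t ∪ Finset.univ.image h) →
      ∑ e, z e * (if u e ∈ R then 1 else 0) = ∑ v ∈ T, ∑ e, if u e = v then z e else 0 := by
    intro u hu
    rw [Finset.sum_comm]
    refine Finset.sum_congr rfl fun e _ => ?_
    rw [Finset.sum_ite_eq]
    have := hu e
    simp only [T, Finset.mem_filter, this, true_and]
    split_ifs <;> simp
  simp only [mul_sub, Finset.sum_sub_distrib]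
  rw [key t (by simp), key h (by simp), ← Finset.sum_sub_distrib]
  exact Finset.sum_eq_zero fun v _ => hz v

/-- One can step from `u` to `v` forwards along an edge in `P` or backwards along one in `M`. -/
def ResidualStep (t h : F → V) (P M : F → Prop) (u v : V) : Prop :=
  ∃ e, (P e ∧ t e = u ∧ h e = v) ∨ (M e ∧ h e = u ∧ t e = v)

/-- A residual path carries a unit of flow. -/
theorem exists_unit_flow {t h : F → V} {P M : F → Prop} {u v : V}
    (huv : Relation.ReflTransGen (ResidualStep t h P M) u v) :
    ∃ z : F → ℝ, (∀ e, 0 < z e → P e) ∧ (∀ e, z e < 0 → M e) ∧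
      ∀ w, netOut t h z w = (if u = w then 1 else 0) - if v = w then 1 else 0 := by
  classical
  induction huv with
  | refl => exact ⟨0, by simp, by simp, by simp [netOut]⟩
  | tail _ hstep ih =>
    obtain ⟨z, hP, hM, hz⟩ := ih
    obtain ⟨e, ⟨he, rfl, rfl⟩ | ⟨he, rfl, rfl⟩⟩ := hstep
    · refine ⟨z + Pi.single e 1, fun x hx => ?_, fun x hx => ?_, fun w => ?_⟩
      · rcases eq_or_ne x e with rfl | hxe
        · exact he
        · exact hP x (by simpa [hxe] using hx)
      · rcases eq_or_ne x e with rfl | hxe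
        · simp only [Pi.add_apply, Pi.single_eq_same] at hx
          exact hM x (by linarith)
        · exact hM x (by simpa [hxe] using hx)
      · rw [netOut_add, hz, netOut_single]
        ring
    · refine ⟨z + Pi.single e (-1), fun x hx => ?_, fun x hx => ?_, fun w => ?_⟩
      · rcases eq_or_ne x e with rfl | hxe
        · simp only [Pi.add_apply, Pi.single_eq_same] at hx
          exact hP x (by linarith)
        · exact hP x (by simpa [hxe] using hx)
      · rcases eq_or_ne x e with rfl | hxe
        · exact he
        · exact hM x (by simpa [hxe] using hx)
      · rw [netOut_add, hz, netOut_single]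
        split_ifs <;> ring

/-- If a circulation `d` contains no cycle avoiding the edge `a`, then `d a` is an upper bound for
its coordinates. -/
theorem abs_le_of_no_cycle {t h : F → V} {d : F → ℝ} (hd : ∀ v, netOut t h d v = 0) {a : F}
    (ha : 0 ≤ d a)
    (hcyc : ∀ z : F → ℝ, (∀ v, netOut t h z v = 0) → (∀ e, 0 < z e → 0 < d e) →
      (∀ e, z e < 0 → d e < 0) → z a = 0 → z = 0) (b : F) : |d b| ≤ d a := by
  classical
  rcases eq_or_ne b a with rfl | hba
  · rw [abs_of_nonneg ha]
  rcases lt_trichotomy (d b) 0 with hb | hb | hb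
  rotate_left
  · rw [hb, abs_zero]
    exact ha
  all_goals
    set P : F → Prop := fun e => e ≠ a ∧ 0 < d e with hPdef
    set M : F → Prop := fun e => e ≠ a ∧ d e < 0 with hMdef
  -- Case `0 < d b`. A path from the head of `b` back to its tail would close up with `b` to a
  -- nonzero circulation with the signs of `d` that avoids `a`. The path itself may use `b`, but
  -- only forwards, so nothing cancels there.
  · have hnot : ¬ Relation.ReflTransGen (ResidualStep t h P M) (h b) (t b) := by
      intro hp
      obtain ⟨z, hzP, hzM, hz⟩ := exists_unit_flow hp
      have hb0 : 0 ≤ z b := by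
        by_contra! hlt
        exact lt_asymm hb (hzM b hlt).2
      have h0 := hcyc (z + Pi.single b 1) (fun v => by rw [netOut_add, hz, netOut_single]; ring)
        (fun e he => by
          rcases eq_or_ne e b with rfl | heb
          · exact hb
          · exact (hzP e (by simpa [heb] using he)).2)
        (fun e he => by
          rcases eq_or_ne e b with rfl | heb
          · simp only [Pi.add_apply, Pi.single_eq_same] at he
            linarith
          · exact (hzM e (by simpa [heb] using he)).2)
        (by
          have h1 : ¬ 0 < z a := fun hlt => (hzP a hlt).1 rfl
          have h2 : ¬ z a < 0 := fun hlt => (hzM a hlt).1 rfl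
          simp only [Pi.add_apply, Pi.single_eq_of_ne hba.symm]
          linarith)
      have := congrFun h0 b
      simp only [Pi.add_apply, Pi.single_eq_same, Pi.zero_apply] at this
      linarith
    -- Across the set `R` of vertices reachable from the head of `b`, the edge `b` contributes `-d
    -- b` to the net outflow, `a` at most `d a`, and any other edge nothing positive, since
    -- otherwise `R` could be extended. The total is zero.
    have hcut := sum_cut_eq_zero hd
      {v | Relation.ReflTransGen (ResidualStep t h P M) (h b) v}
    set R : Set V := {v | Relation.ReflTransGen (ResidualStep t h P M) (h b) v}
    have hle : ∀ e, d e * ((if t e ∈ R then 1 else 0) - if h e ∈ R then 1 else 0) ≤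
        (Pi.single a (d a) + Pi.single b (-d b) : F → ℝ) e := by
      intro e
      rcases eq_or_ne e b with rfl | heb
      · have h1 : t e ∉ R := hnot
        have h2 : h e ∈ R := Relation.ReflTransGen.refl
        simp [h1, h2, hba]
      rcases eq_or_ne e a with rfl | hea
      · simp only [Pi.add_apply, Pi.single_eq_same, Pi.single_eq_of_ne heb]
        split_ifs <;> linarith
      · simp only [Pi.add_apply, Pi.single_eq_of_ne heb, Pi.single_eq_of_ne hea, add_zero]
        rcases lt_trichotomy (d e) 0 with he | he | he
        · have : h e ∈ R → t e ∈ R := fun hR => hR.tail ⟨e, Or.inr ⟨⟨hea, he⟩, rfl, rfl⟩⟩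
          split_ifs <;> first | (exfalso; tauto) | linarith
        · simp [he]
        · have : t e ∈ R → h e ∈ R := fun hR => hR.tail ⟨e, Or.inl ⟨⟨hea, he⟩, rfl, rfl⟩⟩
          split_ifs <;> first | (exfalso; tauto) | linarith
    have := Finset.sum_le_sum fun e (_ : e ∈ Finset.univ) => hle e
    rw [hcut] at this
    simp only [Pi.add_apply, Finset.sum_add_distrib, Finset.sum_pi_single', Finset.mem_univ,
      if_true] at this
    rw [abs_of_pos hb]
    linarith
  -- Case `d b < 0`: the mirror image, with `b` traversed backwards.
  · have hnot : ¬ Relation.ReflTransGen (ResidualStep t h P M) (t b) (h b) := by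
      intro hp
      obtain ⟨z, hzP, hzM, hz⟩ := exists_unit_flow hp
      have hb0 : z b ≤ 0 := by
        by_contra! hlt
        exact lt_asymm hb (hzP b hlt).2
      have h0 := hcyc (z + Pi.single b (-1))
        (fun v => by rw [netOut_add, hz, netOut_single]; split_ifs <;> ring)
        (fun e he => by
          rcases eq_or_ne e b with rfl | heb
          · simp only [Pi.add_apply, Pi.single_eq_same] at he
            linarith
          · exact (hzP e (by simpa [heb] using he)).2)
        (fun e he => by
          rcases eq_or_ne e b with rfl | heb
          · exact hb
          · exact (hzM e (by simpa [heb] using he)).2)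
        (by
          have h1 : ¬ 0 < z a := fun hlt => (hzP a hlt).1 rfl
          have h2 : ¬ z a < 0 := fun hlt => (hzM a hlt).1 rfl
          simp only [Pi.add_apply, Pi.single_eq_of_ne hba.symm]
          linarith)
      have := congrFun h0 b
      simp only [Pi.add_apply, Pi.single_eq_same, Pi.zero_apply] at this
      linarith
    have hcut := sum_cut_eq_zero hd
      {v | Relation.ReflTransGen (ResidualStep t h P M) (t b) v}
    set R : Set V := {v | Relation.ReflTransGen (ResidualStep t h P M) (t b) v}
    have hle : ∀ e, d e * ((if t e ∈ R then 1 else 0) - if h e ∈ R then 1 else 0) ≤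
        (Pi.single a (d a) + Pi.single b (d b) : F → ℝ) e := by
      intro e
      rcases eq_or_ne e b with rfl | heb
      · have h1 : h e ∉ R := hnot
        have h2 : t e ∈ R := Relation.ReflTransGen.refl
        simp [h1, h2, hba]
      rcases eq_or_ne e a with rfl | hea
      · simp only [Pi.add_apply, Pi.single_eq_same, Pi.single_eq_of_ne heb]
        split_ifs <;> linarith
      · simp only [Pi.add_apply, Pi.single_eq_of_ne heb, Pi.single_eq_of_ne hea, add_zero]
        rcases lt_trichotomy (d e) 0 with he | he | he
        · have : h e ∈ R → t e ∈ R := fun hR => hR.tail ⟨e, Or.inr ⟨⟨hea, he⟩, rfl, rfl⟩⟩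
          split_ifs <;> first | (exfalso; tauto) | linarith
        · simp [he]
        · have : t e ∈ R → h e ∈ R := fun hR => hR.tail ⟨e, Or.inl ⟨⟨hea, he⟩, rfl, rfl⟩⟩
          split_ifs <;> first | (exfalso; tauto) | linarith
    have := Finset.sum_le_sum fun e (_ : e ∈ Finset.univ) => hle e
    rw [hcut] at this
    simp only [Pi.add_apply, Finset.sum_add_distrib, Finset.sum_pi_single', Finset.mem_univ,
      if_true] at this
    rw [abs_of_neg hb]
    linarith

end Circulation

/-! ### Lexicographically maximal flows: compactness, nonexpansiveness, minimum cuts -/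

namespace FlowNetwork

variable {V E : Type*} [DecidableEq V] [Fintype E]

theorem sum_withBot (z : WithBot E → ℝ) : ∑ e, z e = z ⊥ + ∑ e : E, z e :=
  Fintype.sum_option z

theorem mem_flows_iff {G : FlowNetwork V E} {c : E → ℝ} {f : WithBot E → ℝ} :
    f ∈ G.flows c ↔ (∀ e, 0 ≤ f e) ∧ (∀ e : E, f e ≤ c e) ∧
      ∀ v, netOut G.extTail G.extHead f v = 0 := by
  simp only [flows, Set.mem_ofPred_eq, netOut, sub_eq_zero]

theorem isClosed_flows (G : FlowNetwork V E) (c : E → ℝ) : IsClosed (G.flows c) := by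
  have h1 : IsClosed {f : WithBot E → ℝ | ∀ e, 0 ≤ f e} := by
    simp only [Set.ofPred_forall]
    exact isClosed_iInter fun e => isClosed_le continuous_const (continuous_apply e)
  have h2 : IsClosed {f : WithBot E → ℝ | ∀ e : E, f e ≤ c e} := by
    simp only [Set.ofPred_forall]
    exact isClosed_iInter fun e => isClosed_le (continuous_apply _) continuous_const
  have h3 : IsClosed {f : WithBot E → ℝ | ∀ v : V,
      (∑ e, if G.extTail e = v then f e else 0) = ∑ e, if G.extHead e = v then f e else 0} := by
    simp only [Set.ofPred_forall]
    refine isClosed_iInter fun v => isClosed_eq ?_ ?_ <;>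
    · refine continuous_finsetSum _ fun e _ => ?_
      split_ifs <;> fun_prop
  exact h1.inter (h2.inter h3)

/-- Needed for compactness. The fictitious edge has no capacity of its own, but conservation at the
source bounds its flow by that of the real edges leaving the source; this uses that source and sink
differ. -/
theorem le_sum_of_mem_flows {G : FlowNetwork V E} {c : E → ℝ} (hc : ∀ e, 0 ≤ c e)
    {f : WithBot E → ℝ} (hf : f ∈ G.flows c) (e : WithBot E) : f e ≤ ∑ e, c e := by
  obtain ⟨h0, hle, hcons⟩ := hf
  induction e using WithBot.recBotCoe with
  | bot =>
    have h := hcons G.source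
    rw [sum_withBot, sum_withBot] at h
    have ht : G.extTail ⊥ = G.sink := rfl
    have hh : G.extHead ⊥ = G.source := rfl
    rw [ht, hh, if_neg G.source_ne_sink.symm, if_pos rfl, zero_add] at h
    have h1 : (∑ e : E, if G.extTail e = G.source then f e else 0) ≤ ∑ e, c e :=
      Finset.sum_le_sum fun e _ => by
        split_ifs
        · exact hle e
        · exact hc e
    have h2 : 0 ≤ ∑ e : E, if G.extHead e = G.source then f e else 0 :=
      Finset.sum_nonneg fun e _ => by
        split_ifs
        · exact h0 e
        · exact le_rfl
    linarith
  | coe e =>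
    exact (hle e).trans (Finset.single_le_sum (fun e _ => hc e) (Finset.mem_univ e))

theorem isCompact_flows (G : FlowNetwork V E) {c : E → ℝ} (hc : ∀ e, 0 ≤ c e) :
    IsCompact (G.flows c) :=
  (isCompact_Icc (a := (0 : WithBot E → ℝ)) (b := fun _ => ∑ e, c e)).of_isClosed_subset
    (G.isClosed_flows c) fun _ hf => ⟨hf.1, le_sum_of_mem_flows hc hf⟩

/-- A residual circulation is a feasible direction. -/
theorem exists_pos_add_smul_mem_flows {G : FlowNetwork V E} {c : E → ℝ} {f z : WithBot E → ℝ}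
    (hf : f ∈ G.flows c) (hz : ∀ v, netOut G.extTail G.extHead z v = 0)
    (hup : ∀ e : E, 0 < z e → f e < c e) (hdown : ∀ e, z e < 0 → 0 < f e) :
    ∃ δ : ℝ, 0 < δ ∧ f + δ • z ∈ G.flows c := by
  obtain ⟨h0, hle, hcons⟩ := mem_flows_iff.1 hf
  have hlim : ∀ e, Filter.Tendsto (fun δ : ℝ => f e + δ * z e)
      (nhdsWithin 0 (Set.Ioi 0)) (nhds (f e)) := fun e => by
    have : Continuous fun δ : ℝ => f e + δ * z e := by fun_prop
    simpa using (this.tendsto 0).mono_left nhdsWithin_le_nhds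
  have hpos : ∀ᶠ δ : ℝ in nhdsWithin 0 (Set.Ioi 0), 0 < δ := self_mem_nhdsWithin
  have h1 : ∀ᶠ δ : ℝ in nhdsWithin 0 (Set.Ioi 0), ∀ e, 0 ≤ f e + δ * z e := by
    refine Filter.eventually_all.2 fun e => ?_
    rcases lt_or_ge (z e) 0 with he | he
    · filter_upwards [(hlim e).eventually (lt_mem_nhds (hdown e he))] with δ hδ using hδ.le
    · filter_upwards [hpos] with δ hδ using add_nonneg (h0 e) (mul_nonneg hδ.le he)
  have h2 : ∀ᶠ δ : ℝ in nhdsWithin 0 (Set.Ioi 0), ∀ e : E, f e + δ * z e ≤ c e := by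
    refine Filter.eventually_all.2 fun e => ?_
    rcases lt_or_ge 0 (z e) with he | he
    · filter_upwards [(hlim e).eventually (gt_mem_nhds (hup e he))] with δ hδ using hδ.le
    · filter_upwards [hpos] with δ hδ
      nlinarith [hle e, mul_nonneg hδ.le (neg_nonneg.2 he)]
  obtain ⟨δ, hδ, h1, h2⟩ := (hpos.and (h1.and h2)).exists
  refine ⟨δ, hδ, mem_flows_iff.2 ⟨fun e => by simpa using h1 e, fun e => by simpa using h2 e,
    fun v => ?_⟩⟩
  rw [netOut_add, netOut_smul, hcons, hz]
  simp

theorem netOut_neg_eq_zero {t h : E → V} {z : E → ℝ} {v : V} (hz : netOut t h z v = 0) :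
    netOut t h (-z) v = 0 := by
  rw [← neg_one_smul ℝ z, netOut_smul, hz, mul_zero]

variable [LinearOrder E]

theorem existsUnique_isLexMax (G : FlowNetwork V E) {c : E → ℝ} (hc : ∀ e, 0 ≤ c e) :
    ∃! f, IsLexMax (G.flows c) f := by
  obtain ⟨f, hf⟩ := (G.isCompact_flows hc).exists_isLexMax ⟨0, by simp [flows, hc]⟩
  exact ⟨f, hf, fun g hg => hg.eq hf⟩

/-- There is no nonzero circulation which is feasible from one lexicographic maximum and whose
opposite is feasible from another. -/
theorem eq_zero_of_isLexMax {G : FlowNetwork V E} {c c' : E → ℝ} {f f' z : WithBot E → ℝ}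
    (hf : IsLexMax (G.flows c) f) (hf' : IsLexMax (G.flows c') f')
    (hz : ∀ v, netOut G.extTail G.extHead z v = 0)
    (hup : ∀ e, 0 < z e → f e < f' e) (hdown : ∀ e, z e < 0 → f' e < f e)
    (hcap : ∀ e : E, 0 < z e → f e < c e) (hcap' : ∀ e : E, z e < 0 → f' e < c' e) : z = 0 := by
  have h1 := exists_pos_add_smul_mem_flows hf.1 hz hcap
    fun e he => (hf'.1.1 e).trans_lt (hdown e he)
  have h2 := exists_pos_add_smul_mem_flows hf'.1 (z := -z) (fun v => netOut_neg_eq_zero (hz v))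
    (fun e he => hcap' e (by simpa using he))
    fun e he => (hf.1.1 e).trans_lt (hup e (by simpa using he))
  funext k
  induction k using WellFoundedLT.induction with
  | ind k ih =>
    refine le_antisymm (hf.direction_nonpos h1 ih) ?_
    have := hf'.direction_nonpos h2 (k := k) fun l hl => by simp [ih l hl]
    simpa using this

/-- The exchange argument for an increased capacity. Only at `a` can the flow `f'` exceed the old
capacity, so `a` is the only edge where adding `z` to `f` may be infeasible. -/
theorem abs_sub_le_of_le {G : FlowNetwork V E} {c : E → ℝ} {a : E} {x : ℝ} (hx : c a ≤ x)
    {f f' : WithBot E → ℝ} (hf : IsLexMax (G.flows c) f)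
    (hf' : IsLexMax (G.flows (Function.update c a x)) f') (e : WithBot E) :
    |f' e - f e| ≤ x - c a := by
  have hle : c ≤ Function.update c a x := by
    intro e
    rcases eq_or_ne e a with rfl | h <;> simp [*]
  have hd : ∀ v, netOut G.extTail G.extHead (f' - f) v = 0 := fun v => by
    rw [sub_eq_add_neg, netOut_add, (mem_flows_iff.1 hf'.1).2.2 v,
      netOut_neg_eq_zero ((mem_flows_iff.1 hf.1).2.2 v), zero_add]
  have key : ∀ z : WithBot E → ℝ, (∀ v, netOut G.extTail G.extHead z v = 0) →
      (∀ e, 0 < z e → 0 < (f' - f) e) → (∀ e, z e < 0 → (f' - f) e < 0) →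
      (0 < z a → f a < c a) → z = 0 := by
    intro z hz hup hdown ha
    have hup' : ∀ e, 0 < z e → f e < f' e := fun e he => sub_pos.1 (hup e he)
    have hdown' : ∀ e, z e < 0 → f' e < f e := fun e he =>
      sub_neg.1 (hdown e he)
    refine eq_zero_of_isLexMax hf hf' hz hup' hdown' (fun e he => ?_) fun e he =>
      (hdown' e he).trans_le ((hf.1.2.1 e).trans (hle e))
    rcases eq_or_ne e a with rfl | hea
    · exact ha he
    · exact (hup' e he).trans_le (by simpa [hea] using hf'.1.2.1 e)
  -- If the proviso of `key` holds for `f' - f` itself, the two flows coincide. Otherwise `f`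
  -- saturates `a`, whence `(f' - f) a ≤ x - c a`, and the proviso is vacuous for every `z` with `z
  -- a = 0`.
  by_cases h : 0 < (f' - f) a → f a < c a
  · have h0 := congrFun (key (f' - f) hd (fun _ => id) (fun _ => id) h) e
    simp only [Pi.sub_apply, Pi.zero_apply] at h0
    rw [h0, abs_zero]
    linarith
  · push Not at h
    have hmax : f' a ≤ x := by simpa using hf'.1.2.1 a
    have := abs_le_of_no_cycle hd h.1.le
      (fun z hz hup hdown h0 => key z hz hup hdown fun h' => absurd h0 h'.ne') e
    simp only [Pi.sub_apply] at this
    linarith [h.2]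

/-- The lexicographically maximal flow depends on each capacity in a nonexpansive way. -/
theorem abs_sub_le_of_update {G : FlowNetwork V E} {c : E → ℝ} {a : E} {x : ℝ}
    {f f' : WithBot E → ℝ} (hf : IsLexMax (G.flows c) f)
    (hf' : IsLexMax (G.flows (Function.update c a x)) f') (e : WithBot E) :
    |f' e - f e| ≤ |x - c a| := by
  rcases le_total (c a) x with h | h
  · exact (abs_sub_le_of_le h hf hf' e).trans (le_abs_self _)
  -- A decrease is an increase with the two networks interchanged.
  · have hf2 : IsLexMax (G.flows (Function.update (Function.update c a x) a (c a))) f := by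
      simpa using hf
    rw [abs_sub_comm, abs_sub_comm x (c a)]
    refine (abs_sub_le_of_le (by simpa using h) hf' hf2 e).trans ?_
    simpa using le_abs_self (c a - x)

/-- The capacities are replaced one at a time, through the mixtures `s.piecewise c' c`; each of
these has a lexicographic maximum because its capacities are nonnegative. -/
theorem abs_sub_le_sum {G : FlowNetwork V E} {c c' : E → ℝ} (hc : ∀ e, 0 ≤ c e)
    (hc' : ∀ e, 0 ≤ c' e) {f f' : WithBot E → ℝ} (hf : IsLexMax (G.flows c) f)
    (hf' : IsLexMax (G.flows c') f') (e : WithBot E) :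
    |f' e - f e| ≤ ∑ a, |c' a - c a| := by
  have key : ∀ s : Finset E, ∀ g, IsLexMax (G.flows (s.piecewise c' c)) g →
      |g e - f e| ≤ ∑ a ∈ s, |c' a - c a| := by
    intro s
    induction s using Finset.induction_on with
    | empty =>
      intro g hg
      rw [Finset.piecewise_empty] at hg
      simp [hg.eq hf]
    | insert a s ha ih =>
      intro g hg
      obtain ⟨g₀, hg₀, -⟩ := G.existsUnique_isLexMax (c := s.piecewise c' c) fun e => by
        by_cases he : e ∈ s <;> simp [he, hc, hc']
      rw [Finset.piecewise_insert] at hg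
      have h1 := abs_sub_le_of_update hg₀ hg e
      rw [Finset.piecewise_eq_of_notMem _ _ _ ha] at h1
      rw [Finset.sum_insert ha]
      exact (abs_sub_le _ (g₀ e) _).trans (add_le_add h1 (ih g₀ hg₀))
  exact key Finset.univ f' (by rwa [Finset.piecewise_univ])

open Classical in
/-- The value of a lexicographically maximal flow is at least the capacity of some cut. -/
theorem exists_cut_le {G : FlowNetwork V E} {c : E → ℝ} {f : WithBot E → ℝ}
    (hf : IsLexMax (G.flows c) f) : ∃ R : Set V, G.source ∈ R ∧ G.sink ∉ R ∧
      ∑ e, (if G.tail e ∈ R ∧ G.head e ∉ R then c e else 0) ≤ f ⊥ := by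
  set P : WithBot E → Prop := fun x => ∃ e : E, x = e ∧ f e < c e
  set M : WithBot E → Prop := fun x => ∃ e : E, x = e ∧ 0 < f e
  -- An augmenting path, closed by the fictitious edge, would increase `f ⊥`. Since `⊥` is the least
  -- index, maximality there is plain maximality of the flow value.
  have hnot : ¬ Relation.ReflTransGen (ResidualStep G.extTail G.extHead P M) G.source G.sink := by
    intro hp
    obtain ⟨z, hP, hM, hz⟩ := exists_unit_flow hp
    have h1 : ¬ 0 < z ⊥ := fun h => by
      obtain ⟨e, he, -⟩ := hP ⊥ h
      exact WithBot.bot_ne_coe he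
    have h2 : ¬ z ⊥ < 0 := fun h => by
      obtain ⟨e, he, -⟩ := hM ⊥ h
      exact WithBot.bot_ne_coe he
    have hex := exists_pos_add_smul_mem_flows (z := z + Pi.single ⊥ 1) hf.1
      (fun v => by
        rw [netOut_add, hz, netOut_single]
        change _ + ((if G.sink = v then (1 : ℝ) else 0) - if G.source = v then 1 else 0) = 0
        ring)
      (fun e he => by
        obtain ⟨e', he', h⟩ := hP e (by simpa using he)
        rwa [WithBot.coe_inj.1 he'])
      (fun e he => by
        have : z e < 0 := by
          refine lt_of_le_of_lt ?_ he
          have : (0 : ℝ) ≤ (Pi.single ⊥ 1 : WithBot E → ℝ) e := by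
            rcases eq_or_ne e ⊥ with rfl | h <;> simp [*]
          simpa using this
        obtain ⟨e', rfl, h⟩ := hM e this
        exact h)
    have := hf.direction_nonpos hex (k := ⊥) fun l hl => absurd hl not_lt_bot
    simp only [Pi.add_apply, Pi.single_eq_same] at this
    linarith
  set R : Set V := {v | Relation.ReflTransGen (ResidualStep G.extTail G.extHead P M) G.source v}
  have hs : G.source ∈ R := Relation.ReflTransGen.refl
  have ht : G.sink ∉ R := hnot
  refine ⟨R, hs, ht, ?_⟩
  -- Edges leaving `R` are saturated and edges entering `R` are empty, so the net outflow through
  -- real edges is the capacity of the cut, and `⊥` returns it.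
  have hcut := sum_cut_eq_zero (mem_flows_iff.1 hf.1).2.2 R
  rw [sum_withBot] at hcut
  have hT : G.extTail ⊥ = G.sink := rfl
  have hH : G.extHead ⊥ = G.source := rfl
  rw [hT, hH, if_neg ht, if_pos hs] at hcut
  have hle : ∀ e : E, (if G.tail e ∈ R ∧ G.head e ∉ R then c e else 0) ≤
      f e * ((if G.extTail e ∈ R then 1 else 0) - if G.extHead e ∈ R then 1 else 0) := by
    intro e
    have hTe : G.extTail e = G.tail e := rfl
    have hHe : G.extHead e = G.head e := rfl
    rw [hTe, hHe]
    by_cases h1 : G.tail e ∈ R <;> by_cases h2 : G.head e ∈ R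
    · simp [h1, h2]
    · have : c e ≤ f e := by
        by_contra! h
        exact h2 (h1.tail ⟨e, Or.inl ⟨⟨e, rfl, h⟩, rfl, rfl⟩⟩)
      simpa [h1, h2] using this
    · have : f e ≤ 0 := by
        by_contra! h
        exact h1 (h2.tail ⟨e, Or.inr ⟨⟨e, rfl, h⟩, rfl, rfl⟩⟩)
      simpa [h1, h2] using this
    · simp [h1, h2]
  have := Finset.sum_le_sum fun e (_ : e ∈ Finset.univ) => hle e
  linarith

end FlowNetwork

/-! ### Transportation problems as network flows -/

namespace Transport

variable {ι : Type*}

/-- The edges of the transportation network: from the source to the rows, from the columns to the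
sink, and from the rows to the columns. -/
abbrev Edge (ι : Type*) := (ι ⊕ₗ ι) ⊕ₗ (ι ×ₗ ι)

/-- The edge from the source to the row `i`. -/
def rowEdge (i : ι) : Edge ι := toLex (Sum.inl (toLex (Sum.inl i)))

/-- The edge from the column `j` to the sink. -/
def colEdge (j : ι) : Edge ι := toLex (Sum.inl (toLex (Sum.inr j)))

/-- The edge from a row to a column. -/
def midEdge (p : ι ×ₗ ι) : Edge ι := toLex (Sum.inr p)

/-- The function on edges with the given values on the three kinds of edges. -/
def edgeElim {X : Type*} (r s : ι → X) (m : ι ×ₗ ι → X) (e : Edge ι) : X :=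
  Sum.elim (fun x => Sum.elim r s (ofLex x)) m (ofLex e)

section

variable {X : Type*} (r s : ι → X) (m : ι ×ₗ ι → X)

@[simp] theorem edgeElim_rowEdge (i : ι) : edgeElim r s m (rowEdge i) = r i := rfl
@[simp] theorem edgeElim_colEdge (j : ι) : edgeElim r s m (colEdge j) = s j := rfl
@[simp] theorem edgeElim_midEdge (p : ι ×ₗ ι) : edgeElim r s m (midEdge p) = m p := rfl

end

theorem forall_edge {p : Edge ι → Prop} :
    (∀ e, p e) ↔ (∀ i, p (rowEdge i)) ∧ (∀ j, p (colEdge j)) ∧ ∀ q, p (midEdge q) := by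
  refine ⟨fun h => ⟨fun _ => h _, fun _ => h _, fun _ => h _⟩, fun ⟨h1, h2, h3⟩ e => ?_⟩
  match e with
  | Sum.inl (Sum.inl i) => exact h1 i
  | Sum.inl (Sum.inr j) => exact h2 j
  | Sum.inr q => exact h3 q

theorem sum_lex_prod [Fintype ι] (F : ι ×ₗ ι → ℝ) : ∑ p, F p = ∑ i, ∑ j, F (toLex (i, j)) := by
  rw [← Fintype.sum_prod_type']
  exact (Equiv.sum_comp toLex F).symm

theorem sum_edge [Fintype ι] (F : Edge ι → ℝ) :
    ∑ e, F e = ∑ i, F (rowEdge i) + ∑ j, F (colEdge j) + ∑ i, ∑ j, F (midEdge (toLex (i, j))) := by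
  rw [← sum_lex_prod fun p => F (midEdge p), ← Equiv.sum_comp toLex F, Fintype.sum_sum_type,
    ← Equiv.sum_comp toLex fun x => F (toLex (Sum.inl x)), Fintype.sum_sum_type]
  rfl

/-- The vertices of the transportation network: the source, the rows, the columns and the sink. -/
abbrev Vertex (ι : Type*) := Option ι ⊕ Option ι

/-- The transportation network. -/
def network (ι : Type*) : FlowNetwork (Vertex ι) (Edge ι) where
  source := Sum.inl none
  sink := Sum.inr none
  source_ne_sink := by simp
  tail := edgeElim (fun _ => Sum.inl none) (fun j => Sum.inr (some j))
    fun p => Sum.inl (some (ofLex p).1)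
  head := edgeElim (fun i => Sum.inl (some i)) (fun _ => Sum.inr none)
    fun p => Sum.inr (some (ofLex p).2)

/-- The capacities of the transportation network with row supplies `a`, column demands `b` and
capacities `u`. -/
def capacity (a b : ι → ℝ) (u : ι → ι → ℝ) : Edge ι → ℝ :=
  edgeElim a b fun p => u (ofLex p).1 (ofLex p).2

/-- The transportation plans with row sums `a`, column sums `b` and capacities `u`. -/
def plans [Fintype ι] (a b : ι → ℝ) (u : ι → ι → ℝ) : Set (ι ×ₗ ι → ℝ) :=
  {f | (∀ i j, 0 ≤ f (toLex (i, j)) ∧ f (toLex (i, j)) ≤ u i j) ∧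
    (∀ i, ∑ j, f (toLex (i, j)) = a i) ∧ (∀ j, ∑ i, f (toLex (i, j)) = b j)}

variable [Fintype ι] [DecidableEq ι]

theorem conservation_iff (g : WithBot (Edge ι) → ℝ) :
    (∀ v, (∑ e, if (network ι).extTail e = v then g e else 0) =
      ∑ e, if (network ι).extHead e = v then g e else 0) ↔
    (∑ i : ι, g (rowEdge i) = g ⊥ ∧ ∑ j : ι, g (colEdge j) = g ⊥) ∧
    (∀ i : ι, ∑ j, g (midEdge (toLex (i, j))) = g (rowEdge i)) ∧
    ∀ j : ι, ∑ i, g (midEdge (toLex (i, j))) = g (colEdge j) := by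
  have hTb : (network ι).extTail ⊥ = Sum.inr none := rfl
  have hHb : (network ι).extHead ⊥ = Sum.inl none := rfl
  have hT : ∀ e : Edge ι, (network ι).extTail e = (network ι).tail e := fun _ => rfl
  have hH : ∀ e : Edge ι, (network ι).extHead e = (network ι).head e := fun _ => rfl
  simp only [FlowNetwork.sum_withBot, hTb, hHb, hT, hH, sum_edge, Sum.forall, Option.forall]
  simp [network]
  constructor
  · rintro ⟨⟨h1, h2⟩, h3, h4⟩
    exact ⟨⟨h1, h3.symm⟩, h2, fun j => (h4 j).symm⟩
  · rintro ⟨⟨h1, h3⟩, h2, h4⟩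
    exact ⟨⟨h1, h2⟩, h3.symm, fun j => (h4 j).symm⟩

theorem mem_flows_iff {a b : ι → ℝ} {u : ι → ι → ℝ} {g : WithBot (Edge ι) → ℝ} :
    g ∈ (network ι).flows (capacity a b u) ↔
    (∀ e, 0 ≤ g e) ∧
    ((∀ i : ι, g (rowEdge i) ≤ a i) ∧ (∀ j : ι, g (colEdge j) ≤ b j) ∧
      ∀ p, g (midEdge p) ≤ u (ofLex p).1 (ofLex p).2) ∧
    (∑ i : ι, g (rowEdge i) = g ⊥ ∧ ∑ j : ι, g (colEdge j) = g ⊥) ∧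
    (∀ i : ι, ∑ j, g (midEdge (toLex (i, j))) = g (rowEdge i)) ∧
    ∀ j : ι, ∑ i, g (midEdge (toLex (i, j))) = g (colEdge j) := by
  rw [← conservation_iff]
  exact and_congr Iff.rfl
    (and_congr (forall_edge (p := fun e : Edge ι => g e ≤ capacity a b u e)) Iff.rfl)

open Classical in
/-- A lexicographically maximal flow in the transportation network has value `v`, if `v` is the
total supply and demand and every cut has capacity at least `v`. -/
theorem value_eq [LinearOrder ι] {a b : ι → ℝ} {u : ι → ι → ℝ} {v : ℝ}
    (ha : ∑ i, a i = v) (hb : ∑ j, b j = v)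
    (hcut : ∀ A B : Finset ι, ∑ i ∈ A, a i + ∑ j ∈ B, b j ≤ v + ∑ i ∈ A, ∑ j ∈ B, u i j)
    {g : WithBot (Edge ι) → ℝ} (hg : IsLexMax ((network ι).flows (capacity a b u)) g) :
    g ⊥ = v := by
  obtain ⟨hg0, ⟨hgr, -, -⟩, ⟨hrow, -⟩, -, -⟩ := mem_flows_iff.1 hg.1
  refine le_antisymm ?_ ?_
  · rw [← hrow, ← ha]
    exact Finset.sum_le_sum fun i _ => hgr i
  obtain ⟨R, hs, ht, hR⟩ := FlowNetwork.exists_cut_le hg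
  refine le_trans ?_ hR
  replace hs : Sum.inl none ∈ R := hs
  replace ht : Sum.inr none ∉ R := ht
  -- With `A` the rows on the source side and `B` the columns on the sink side, the cut has capacity
  -- `(v - a(A)) + (v - b(B)) + u(A, B)`, which is at least `v` by `hcut`.
  have hA := Finset.sum_filter_add_sum_filter_not Finset.univ (fun i => Sum.inl (some i) ∈ R) a
  have hB := Finset.sum_filter_add_sum_filter_not Finset.univ (fun j => Sum.inr (some j) ∈ R) b
  have hAB := hcut (Finset.univ.filter fun i => Sum.inl (some i) ∈ R)
    (Finset.univ.filter fun j => Sum.inr (some j) ∉ R)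
  rw [sum_edge]
  have hrow' : ∑ i, (if (network ι).tail (rowEdge i) ∈ R ∧ (network ι).head (rowEdge i) ∉ R
      then capacity a b u (rowEdge i) else 0) = ∑ i with Sum.inl (some i) ∉ R, a i := by
    rw [Finset.sum_filter]
    exact Finset.sum_congr rfl fun i _ => if_congr (and_iff_right hs) rfl rfl
  have hcol' : ∑ j, (if (network ι).tail (colEdge j) ∈ R ∧ (network ι).head (colEdge j) ∉ R
      then capacity a b u (colEdge j) else 0) = ∑ j with Sum.inr (some j) ∈ R, b j := by
    rw [Finset.sum_filter]
    exact Finset.sum_congr rfl fun j _ => if_congr (and_iff_left ht) rfl rfl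
  have hmid : ∑ i, ∑ j, (if (network ι).tail (midEdge (toLex (i, j))) ∈ R ∧
      (network ι).head (midEdge (toLex (i, j))) ∉ R
      then capacity a b u (midEdge (toLex (i, j))) else 0) =
      ∑ i with Sum.inl (some i) ∈ R, ∑ j with Sum.inr (some j) ∉ R, u i j := by
    simp only [Finset.sum_filter]
    refine Finset.sum_congr rfl fun i _ => ?_
    by_cases h : Sum.inl (some i) ∈ R
    · rw [if_pos h]
      exact Finset.sum_congr rfl fun j _ => if_congr (and_iff_right h) rfl rfl
    · rw [if_neg h]
      exact Finset.sum_eq_zero fun j _ => if_neg fun h' => h h'.1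
  rw [hrow', hcol', hmid]
  linarith

/-- If the value of the lexicographically maximal flow in the transportation network is the total
supply and demand, then its restriction is the lexicographically maximal plan. -/
theorem isLexMax_plans [LinearOrder ι] {a b : ι → ℝ} {u : ι → ι → ℝ}
    {g : WithBot (Edge ι) → ℝ} (hg : IsLexMax ((network ι).flows (capacity a b u)) g)
    (ha : ∑ i, a i = g ⊥) (hb : ∑ j, b j = g ⊥) :
    IsLexMax (plans a b u) fun p => g (midEdge p) := by
  obtain ⟨hg0, ⟨hgr, hgc, hgm⟩, ⟨hrow, hcol⟩, hr, hc⟩ := mem_flows_iff.1 hg.1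
  have hra : ∀ i, g (rowEdge i) = a i := fun i =>
    (Finset.sum_eq_sum_iff_of_le fun i _ => hgr i).1 (hrow.trans ha.symm) i (Finset.mem_univ i)
  have hcb : ∀ j, g (colEdge j) = b j := fun j =>
    (Finset.sum_eq_sum_iff_of_le fun j _ => hgc j).1 (hcol.trans hb.symm) j (Finset.mem_univ j)
  refine ⟨⟨fun i j => ⟨hg0 _, hgm _⟩, fun i => (hr i).trans (hra i), fun j => (hc j).trans (hcb j)⟩,
    fun k f hf hk => ?_⟩
  obtain ⟨hfu, hfr, hfc⟩ := hf
  -- A competing plan extends to a flow by saturating all row and column edges, as `g` does. Those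
  -- edges and `⊥` precede every middle edge, so `f'` agrees with `g` on them and the comparison is
  -- decided among middle edges.
  set f' : WithBot (Edge ι) → ℝ := WithBot.recBotCoe (g ⊥) (edgeElim a b f)
  have hf' : f' ∈ (network ι).flows (capacity a b u) := by
    refine mem_flows_iff.2 ⟨fun e => ?_, ⟨fun i => le_rfl, fun j => le_rfl, fun p => (hfu _ _).2⟩,
      ⟨ha, hb⟩, hfr, hfc⟩
    induction e using WithBot.recBotCoe with
    | bot => exact hg0 ⊥
    | coe e =>
      refine forall_edge (p := fun e : Edge ι => 0 ≤ f' e).2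
        ⟨fun i => ?_, fun j => ?_, fun p => (hfu _ _).1⟩ e
      · exact (hg0 _).trans (hgr i)
      · exact (hg0 _).trans (hgc j)
  refine hg.2 (midEdge k) f' hf' fun e he => ?_
  induction e using WithBot.recBotCoe with
  | bot => rfl
  | coe e =>
    revert he
    refine forall_edge (p := fun e : Edge ι => (e : WithBot (Edge ι)) < midEdge k → f' e = g e).2
      ⟨fun i _ => (hra i).symm, fun j _ => (hcb j).symm, fun p hp => hk p ?_⟩ e
    rw [WithBot.coe_lt_coe] at hp
    exact Sum.Lex.inr_lt_inr_iff.1 hp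

end Transport

section Quantum

/-! ### The cut inequality for unitary matrices -/

/-- Orthogonal projections `x` and `y` of `ψ` onto subspaces which make an angle of cosine at most
`c` satisfy an uncertainty relation. -/
theorem norm_sq_add_norm_sq_le {H : Type*} [NormedAddCommGroup H] [InnerProductSpace ℂ H]
    {ψ x y : H} {c : ℝ} (hc : 0 ≤ c) (hx : (inner ℂ ψ x).re = ‖x‖ ^ 2)
    (hy : (inner ℂ ψ y).re = ‖y‖ ^ 2) (hxy : (inner ℂ x y).re ≤ c * (‖x‖ * ‖y‖)) :
    ‖x‖ ^ 2 + ‖y‖ ^ 2 ≤ (1 + c) * ‖ψ‖ ^ 2 := by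
  have h1 := norm_sub_sq (𝕜 := ℂ) (((1 + c : ℝ) : ℂ) • ψ) (x + y)
  have h2 := norm_add_sq (𝕜 := ℂ) x y
  rw [inner_smul_left, inner_add_right, norm_smul, mul_pow] at h1
  simp only [RCLike.re_to_complex, Complex.conj_ofReal, Complex.re_ofReal_mul, Complex.add_re, hx,
    hy, Complex.norm_real, Real.norm_eq_abs, sq_abs] at h1 h2
  -- By `2‖x‖‖y‖ ≤ ‖x‖² + ‖y‖²`; the claim then follows by expanding `0 ≤ ‖(1 + c)ψ - (x + y)‖²`.
  have h3 : ‖x + y‖ ^ 2 ≤ (1 + c) * (‖x‖ ^ 2 + ‖y‖ ^ 2) := by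
    nlinarith [mul_nonneg hc (sq_nonneg (‖x‖ - ‖y‖))]
  have h4 : 0 ≤ (1 + c) * ((1 + c) * ‖ψ‖ ^ 2 - (‖x‖ ^ 2 + ‖y‖ ^ 2)) := by
    nlinarith [sq_nonneg ‖((1 + c : ℝ) : ℂ) • ψ - (x + y)‖]
  linarith [nonneg_of_mul_nonneg_right h4 (by linarith)]

variable {N : ℕ}

/-- The uncertainty relation for two projections of `ψ`: `x` onto the coordinates in `A`, and `y`,
obtained by applying `U`, projecting onto `B` and going back. Their inner product is a sum over `A ×
B` in which each term is at most `‖U j i‖ ‖x‖ ‖y‖`. -/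
theorem sum_norm_sq_add_sum_norm_sq_le {U : Matrix (Fin N) (Fin N) ℂ}
    (hU : U ∈ Matrix.unitaryGroup (Fin N) ℂ) (ψ : Fin N → ℂ) (A B : Finset (Fin N)) :
    ∑ i ∈ A, ‖ψ i‖ ^ 2 + ∑ j ∈ B, ‖(U *ᵥ ψ) j‖ ^ 2 ≤
      (1 + ∑ i ∈ A, ∑ j ∈ B, ‖U j i‖) * ∑ i, ‖ψ i‖ ^ 2 := by
  set x : Fin N → ℂ := fun i => if i ∈ A then ψ i else 0 with hx
  set w : Fin N → ℂ := fun j => if j ∈ B then (U *ᵥ ψ) j else 0 with hw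
  set y : Fin N → ℂ := Uᴴ *ᵥ w with hy
  have hUU : U * Uᴴ = 1 := Matrix.mem_unitaryGroup_iff.1 hU
  have hself : ∀ (z v : Fin N → ℂ) (s : Finset (Fin N)), (∀ i, v i = if i ∈ s then z i else 0) →
      inner ℂ (WithLp.toLp 2 z) (WithLp.toLp 2 v) =
        ((∑ i ∈ s, ‖z i‖ ^ 2 : ℝ) : ℂ) := by
    intro z v s hv
    simp only [PiLp.inner_apply, hv, RCLike.inner_apply]
    rw [Complex.ofReal_sum, ← Finset.sum_subset (Finset.subset_univ s)]
    · refine Finset.sum_congr rfl fun i hi => ?_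
      rw [if_pos hi, Complex.mul_conj, Complex.normSq_eq_norm_sq]
    · intro i _ hi
      simp [hi]
  have hadj : ∀ z : Fin N → ℂ, inner ℂ (WithLp.toLp 2 z) (WithLp.toLp 2 y) =
      inner ℂ (WithLp.toLp 2 (U *ᵥ z)) (WithLp.toLp 2 w) := by
    intro z
    simp only [EuclideanSpace.inner_eq_star_dotProduct, hy]
    rw [Matrix.star_mulVec, dotProduct_comm, dotProduct_comm w, Matrix.dotProduct_mulVec]
  have hnorm : ∀ (z : Fin N → ℂ) (s : Finset (Fin N)),
      ‖(WithLp.toLp 2 fun i => if i ∈ s then z i else 0 : EuclideanSpace ℂ (Fin N))‖ ^ 2 =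
        ∑ i ∈ s, ‖z i‖ ^ 2 := by
    intro z s
    rw [EuclideanSpace.norm_sq_eq, ← Finset.sum_subset (Finset.subset_univ s)]
    · refine Finset.sum_congr rfl fun i hi => ?_
      simp [hi]
    · intro i _ hi
      simp [hi]
  have hyw : ‖(WithLp.toLp 2 y : EuclideanSpace ℂ (Fin N))‖ ^ 2 =
      ‖(WithLp.toLp 2 w : EuclideanSpace ℂ (Fin N))‖ ^ 2 := by
    have : U *ᵥ y = w := by rw [hy, Matrix.mulVec_mulVec, hUU, Matrix.one_mulVec]
    rw [← inner_self_eq_norm_sq (𝕜 := ℂ), ← inner_self_eq_norm_sq (𝕜 := ℂ), hadj, this]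
  have hc : 0 ≤ ∑ i ∈ A, ∑ j ∈ B, ‖U j i‖ :=
    Finset.sum_nonneg fun _ _ => Finset.sum_nonneg fun _ _ => norm_nonneg _
  have key := norm_sq_add_norm_sq_le (ψ := WithLp.toLp 2 ψ) (x := WithLp.toLp 2 x)
    (y := WithLp.toLp 2 y) hc ?_ ?_ ?_
  · rw [hyw, hnorm ψ A, hnorm (U *ᵥ ψ) B, EuclideanSpace.norm_sq_eq] at key
    exact key
  · rw [hself ψ x A fun _ => rfl, hnorm ψ A, Complex.ofReal_re]
  · rw [hadj, hyw, hself (U *ᵥ ψ) w B fun _ => rfl, hnorm (U *ᵥ ψ) B, Complex.ofReal_re]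
  · have hwy : ‖(WithLp.toLp 2 y : EuclideanSpace ℂ (Fin N))‖ =
        ‖(WithLp.toLp 2 w : EuclideanSpace ℂ (Fin N))‖ :=
      (sq_eq_sq₀ (norm_nonneg _) (norm_nonneg _)).1 hyw
    rw [hadj, hwy]
    have hexp : inner ℂ (WithLp.toLp 2 (U *ᵥ x)) (WithLp.toLp 2 w) =
        ∑ i ∈ A, ∑ j ∈ B, w j * (starRingEnd ℂ) (U j i * x i) := by
      simp only [PiLp.inner_apply, RCLike.inner_apply, Matrix.mulVec, dotProduct, map_sum,
        Finset.mul_sum]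
      rw [Finset.sum_comm, ← Finset.sum_subset (Finset.subset_univ A)]
      · refine Finset.sum_congr rfl fun i _ => ?_
        rw [← Finset.sum_subset (Finset.subset_univ B)]
        intro j _ hj
        simp [hw, hj]
      · intro i _ hi
        simp [hx, hi]
    rw [hexp]
    refine (Complex.re_le_norm _).trans ((norm_sum_le _ _).trans ?_)
    rw [Finset.sum_mul]
    refine Finset.sum_le_sum fun i _ => (norm_sum_le _ _).trans ?_
    rw [Finset.sum_mul]
    refine Finset.sum_le_sum fun j _ => ?_
    rw [norm_mul, RCLike.norm_conj, norm_mul, mul_left_comm, mul_comm ‖w j‖]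
    gcongr
    · exact PiLp.norm_apply_le (WithLp.toLp 2 x : EuclideanSpace ℂ (Fin N)) i
    · exact PiLp.norm_apply_le (WithLp.toLp 2 w : EuclideanSpace ℂ (Fin N)) j

/-! ### Mixed states -/

namespace IsMixedState

variable {ρ U : Matrix (Fin N) (Fin N) ℂ}

theorem exists_eq_sum (hρ : IsMixedState ρ) : ∃ (m : ℕ) (v : Fin m → Fin N → ℂ),
    ρ = ∑ k, Matrix.vecMulVec (v k) (star (v k)) :=
  Matrix.posSemidef_iff_eq_sum_vecMulVec.1 hρ.1

theorem sum_vecMulVec_apply_re {m : ℕ} (v : Fin m → Fin N → ℂ) (i : Fin N) :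
    ((∑ k, Matrix.vecMulVec (v k) (star (v k))) i i).re = ∑ k, ‖v k i‖ ^ 2 := by
  rw [Matrix.sum_apply, Complex.re_sum]
  refine Finset.sum_congr rfl fun k _ => ?_
  rw [Matrix.vecMulVec_apply, Pi.star_apply, Complex.star_def, Complex.mul_conj,
    Complex.normSq_eq_norm_sq, Complex.ofReal_re]

theorem conj_sum_vecMulVec {m : ℕ} (v : Fin m → Fin N → ℂ) :
    U * (∑ k, Matrix.vecMulVec (v k) (star (v k))) * Uᴴ =
      ∑ k, Matrix.vecMulVec (U *ᵥ v k) (star (U *ᵥ v k)) := by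
  rw [Finset.mul_sum, Finset.sum_mul]
  refine Finset.sum_congr rfl fun k _ => ?_
  rw [Matrix.mul_vecMulVec, Matrix.vecMulVec_mul, Matrix.star_mulVec]

theorem sum_re_apply (hρ : IsMixedState ρ) : ∑ i, (ρ i i).re = 1 := by
  have := congrArg Complex.re hρ.2
  rwa [Matrix.trace, Complex.re_sum] at this

theorem re_apply_nonneg (hρ : IsMixedState ρ) (i : Fin N) : 0 ≤ (ρ i i).re :=
  (Complex.le_def.1 (hρ.1.diag_nonneg (i := i))).1

theorem conj (hρ : IsMixedState ρ) (hU : U ∈ Matrix.unitaryGroup (Fin N) ℂ) :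
    IsMixedState (U * ρ * Uᴴ) := by
  refine ⟨hρ.1.mul_mul_conjTranspose_same U, ?_⟩
  have hUU : Uᴴ * U = 1 := Matrix.mem_unitaryGroup_iff'.1 hU
  rw [Matrix.trace_mul_comm, ← Matrix.mul_assoc, hUU, Matrix.one_mul, hρ.2]

theorem norm_apply_le_one (hρ : IsMixedState ρ) (i j : Fin N) : ‖ρ i j‖ ≤ 1 := by
  obtain ⟨m, v, hv⟩ := hρ.exists_eq_sum
  have hdiag : ∀ i, ∑ k, ‖v k i‖ ^ 2 ≤ 1 := fun i => by
    rw [← sum_vecMulVec_apply_re, ← hv, ← hρ.sum_re_apply]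
    exact Finset.single_le_sum (fun i _ => hρ.re_apply_nonneg i) (Finset.mem_univ i)
  calc ‖ρ i j‖ = ‖∑ k, v k i * star (v k j)‖ := by
        rw [hv, Matrix.sum_apply]
        rfl
    _ ≤ ∑ k, ‖v k i * star (v k j)‖ := norm_sum_le _ _
    _ ≤ ∑ k, (‖v k i‖ ^ 2 / 2 + ‖v k j‖ ^ 2 / 2) := by
        refine Finset.sum_le_sum fun k _ => ?_
        rw [norm_mul, norm_star]
        nlinarith [sq_nonneg (‖v k i‖ - ‖v k j‖)]
    _ ≤ 1 := by
        rw [Finset.sum_add_distrib, ← Finset.sum_div, ← Finset.sum_div]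
        linarith [hdiag i, hdiag j]

/-- Both sides are additive over a decomposition of `ρ` into rank-one terms `v v*`, and the squared
norms of the vectors `v` sum to the trace, 1. -/
theorem cut_le (hρ : IsMixedState ρ) (hU : U ∈ Matrix.unitaryGroup (Fin N) ℂ)
    (A B : Finset (Fin N)) :
    ∑ i ∈ A, (ρ i i).re + ∑ j ∈ B, ((U * ρ * Uᴴ) j j).re ≤
      1 + ∑ i ∈ A, ∑ j ∈ B, ‖U j i‖ := by
  obtain ⟨m, v, hv⟩ := hρ.exists_eq_sum
  have h1 := hρ.sum_re_apply
  rw [hv, conj_sum_vecMulVec]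
  rw [hv] at h1
  simp only [sum_vecMulVec_apply_re] at h1 ⊢
  rw [Finset.sum_comm] at h1
  rw [Finset.sum_comm, Finset.sum_comm (s := B), ← Finset.sum_add_distrib]
  refine (Finset.sum_le_sum fun k _ => sum_norm_sq_add_sum_norm_sq_le hU (v k) A B).trans ?_
  rw [← Finset.mul_sum, h1, mul_one]

end IsMixedState

/-! ### Existence of the flow that defines the flow theory -/

namespace FlowTheory

open Transport

variable {ρ U : Matrix (Fin N) (Fin N) ℂ}

/-- The lexicographically maximal flow of the flow theory comes from that of a network. -/
theorem exists_isLexMax (hρ : IsMixedState ρ) (hU : U ∈ Matrix.unitaryGroup (Fin N) ℂ) :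
    ∃ g, IsLexMax ((network (Fin N)).flows (capacity (fun i => (ρ i i).re)
      (fun j => ((U * ρ * Uᴴ) j j).re) fun i j => ‖U j i‖)) g ∧
      IsLexMax (maxFlows ρ U) fun p => g (midEdge p) := by
  obtain ⟨g, hg, -⟩ := (network (Fin N)).existsUnique_isLexMax (c := capacity (fun i => (ρ i i).re)
    (fun j => ((U * ρ * Uᴴ) j j).re) fun i j => ‖U j i‖)
    (forall_edge.2 ⟨hρ.re_apply_nonneg, (hρ.conj hU).re_apply_nonneg, fun _ => norm_nonneg _⟩)
  have hv := value_eq hρ.sum_re_apply (hρ.conj hU).sum_re_apply (hρ.cut_le hU) hg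
  refine ⟨g, hg, ?_⟩
  exact isLexMax_plans hg (hρ.sum_re_apply.trans hv.symm) ((hρ.conj hU).sum_re_apply.trans hv.symm)

theorem isLexMax_lexMax_maxFlows (hρ : IsMixedState ρ) (hU : U ∈ Matrix.unitaryGroup (Fin N) ℂ) :
    IsLexMax (maxFlows ρ U) (lexMax (maxFlows ρ U)) := by
  obtain ⟨g, -, h⟩ := exists_isLexMax hρ hU
  rwa [h.lexMax_eq]

end FlowTheory

/-! ### Robustness -/

theorem Equiv.Perm.inv_permMatrix {n R : Type*} [Fintype n] [DecidableEq n] [CommRing R]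
    (σ : Equiv.Perm n) : (σ.permMatrix R)⁻¹ = (σ⁻¹).permMatrix R := by
  refine Matrix.inv_eq_left_inv ?_
  rw [← Matrix.permMatrix_mul, mul_inv_cancel, Matrix.permMatrix_one]

theorem Matrix.permMatrix_mul_mul_inv {n R : Type*} [Fintype n] [DecidableEq n] [CommRing R]
    (σ : Equiv.Perm n) (M : Matrix n n R) :
    σ.permMatrix R * M * (σ.permMatrix R)⁻¹ = M.submatrix σ σ := by
  rw [Equiv.Perm.inv_permMatrix, Equiv.Perm.permMatrix, Equiv.Perm.permMatrix,
    PEquiv.toMatrix_toPEquiv_mul, PEquiv.mul_toMatrix_toPEquiv]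
  rfl

theorem Matrix.inv_permMatrix_mul_mul {n R : Type*} [Fintype n] [DecidableEq n] [CommRing R]
    (σ : Equiv.Perm n) (M : Matrix n n R) :
    (σ.permMatrix R)⁻¹ * M * σ.permMatrix R = M.submatrix ⇑σ⁻¹ ⇑σ⁻¹ := by
  have h := Matrix.permMatrix_mul_mul_inv σ⁻¹ M
  rwa [Equiv.Perm.inv_permMatrix σ⁻¹, inv_inv, ← Equiv.Perm.inv_permMatrix σ] at h

theorem Matrix.norm_submatrix_equiv {n α : Type*} [Fintype n] [SeminormedAddCommGroup α]
    (M : Matrix n n α) (σ : Equiv.Perm n) : ‖M.submatrix σ σ‖ = ‖M‖ := by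
  have h : ∀ (M : Matrix n n α) (σ : Equiv.Perm n), ‖M.submatrix σ σ‖ ≤ ‖M‖ := fun M σ =>
    (Matrix.norm_le_iff (norm_nonneg M)).2 fun i j => M.norm_entry_le_entrywise_sup_norm
  refine le_antisymm (h M σ) ?_
  simpa using h (M.submatrix σ σ) σ⁻¹

theorem Matrix.norm_submatrix_sub_submatrix {n α : Type*} [Fintype n] [SeminormedAddCommGroup α]
    (A B : Matrix n n α) (σ : Equiv.Perm n) :
    ‖A.submatrix σ σ - B.submatrix σ σ‖ = ‖A - B‖ :=
  (A - B).norm_submatrix_equiv σ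

theorem IsMixedState.submatrix {ρ : Matrix (Fin N) (Fin N) ℂ} (hρ : IsMixedState ρ)
    (σ : Equiv.Perm (Fin N)) : IsMixedState (ρ.submatrix σ σ) :=
  ⟨hρ.1.submatrix σ, (Equiv.sum_comp σ fun i => ρ i i).trans hρ.2⟩

theorem Matrix.submatrix_mem_unitaryGroup {U : Matrix (Fin N) (Fin N) ℂ}
    (hU : U ∈ Matrix.unitaryGroup (Fin N) ℂ) (σ : Equiv.Perm (Fin N)) :
    U.submatrix σ σ ∈ Matrix.unitaryGroup (Fin N) ℂ := by
  rw [Matrix.mem_unitaryGroup_iff, Matrix.star_eq_conjTranspose] at *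
  rw [Matrix.conjTranspose_submatrix, Matrix.submatrix_mul_equiv, hU, Matrix.submatrix_one_equiv]

section

variable {ρ ρ' U U' : Matrix (Fin N) (Fin N) ℂ} {ε : ℝ}

/-- The entry is a sum of `N²` triple products whose factors have modulus at most 1; changing the
factors one after another costs `ε` each. -/
theorem norm_conj_apply_sub_le (hρ : IsMixedState ρ) (hρ' : IsMixedState ρ')
    (hU : U ∈ Matrix.unitaryGroup (Fin N) ℂ) (hU' : U' ∈ Matrix.unitaryGroup (Fin N) ℂ)
    (h₁ : ‖ρ' - ρ‖ ≤ ε) (h₂ : ‖U' - U‖ ≤ ε) (j : Fin N) :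
    ‖(U' * ρ' * U'ᴴ) j j - (U * ρ * Uᴴ) j j‖ ≤ 3 * N ^ 2 * ε := by
  have hε : 0 ≤ ε := (norm_nonneg _).trans h₁
  have hexp : ∀ U ρ : Matrix (Fin N) (Fin N) ℂ, (U * ρ * Uᴴ) j j =
      ∑ l, ∑ k, U j k * ρ k l * star (U j l) := fun U ρ => by
    simp [Matrix.mul_apply, Finset.sum_mul]
  have hterm : ∀ l k, ‖U' j k * ρ' k l * star (U' j l) - U j k * ρ k l * star (U j l)‖ ≤
      3 * ε := by
    intro l k
    have e1 : ∀ k, ‖U' j k - U j k‖ ≤ ε := fun k =>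
      (Matrix.norm_entry_le_entrywise_sup_norm (U' - U)).trans h₂
    have e2 : ‖ρ' k l - ρ k l‖ ≤ ε := (Matrix.norm_entry_le_entrywise_sup_norm (ρ' - ρ)).trans h₁
    have e3 : ‖star (U' j l) - star (U j l)‖ ≤ ε := by
      rw [← star_sub, norm_star]
      exact e1 l
    have n1 := entry_norm_bound_of_unitary hU' j l
    have n2 := entry_norm_bound_of_unitary hU j k
    have n3 := hρ.norm_apply_le_one k l
    have n4 := hρ'.norm_apply_le_one k l
    rw [show U' j k * ρ' k l * star (U' j l) - U j k * ρ k l * star (U j l) =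
      (U' j k - U j k) * ρ' k l * star (U' j l) + U j k * (ρ' k l - ρ k l) * star (U' j l) +
        U j k * ρ k l * (star (U' j l) - star (U j l)) by ring]
    have b1 : ‖(U' j k - U j k) * ρ' k l * star (U' j l)‖ ≤ ε * 1 * 1 := by
      rw [norm_mul, norm_mul, norm_star]
      gcongr
      exact e1 k
    have b2 : ‖U j k * (ρ' k l - ρ k l) * star (U' j l)‖ ≤ 1 * ε * 1 := by
      rw [norm_mul, norm_mul, norm_star]
      gcongr
    have b3 : ‖U j k * ρ k l * (star (U' j l) - star (U j l))‖ ≤ 1 * 1 * ε := by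
      rw [norm_mul, norm_mul]
      gcongr
    refine (norm_add₃_le).trans ?_
    linarith
  rw [hexp, hexp, ← Finset.sum_sub_distrib]
  calc _ ≤ ∑ _l : Fin N, ∑ _k : Fin N, 3 * ε := by
        refine (norm_sum_le _ _).trans (Finset.sum_le_sum fun l _ => ?_)
        rw [← Finset.sum_sub_distrib]
        exact (norm_sum_le _ _).trans (Finset.sum_le_sum fun k _ => hterm l k)
    _ = 3 * N ^ 2 * ε := by
        simp
        ring

namespace FlowTheory

open Transport

theorem norm_lexMaxFlow_sub_le (hρ : IsMixedState ρ) (hρ' : IsMixedState ρ')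
    (hU : U ∈ Matrix.unitaryGroup (Fin N) ℂ) (hU' : U' ∈ Matrix.unitaryGroup (Fin N) ℂ)
    (h₁ : ‖ρ' - ρ‖ ≤ ε) (h₂ : ‖U' - U‖ ≤ ε) :
    ‖lexMaxFlow ρ' U' - lexMaxFlow ρ U‖ ≤ 5 * N ^ 3 * ε := by
  have hε : 0 ≤ ε := (norm_nonneg _).trans h₁
  refine (Matrix.norm_le_iff (by positivity)).2 fun j i => ?_
  have hN : (1 : ℝ) ≤ N := by exact_mod_cast i.pos
  obtain ⟨g, hg, hgm⟩ := exists_isLexMax hρ hU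
  obtain ⟨g', hg', hgm'⟩ := exists_isLexMax hρ' hU'
  have hnn : ∀ {ρ U : Matrix (Fin N) (Fin N) ℂ}, IsMixedState ρ →
      U ∈ Matrix.unitaryGroup (Fin N) ℂ → ∀ e, 0 ≤ capacity (fun i => (ρ i i).re)
      (fun j => ((U * ρ * Uᴴ) j j).re) (fun i j => ‖U j i‖) e := fun hρ hU =>
    forall_edge.2 ⟨hρ.re_apply_nonneg, (hρ.conj hU).re_apply_nonneg, fun _ => norm_nonneg _⟩
  have key := FlowNetwork.abs_sub_le_sum (hnn hρ hU) (hnn hρ' hU') hg hg'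
    (midEdge (toLex (i, j)) : Edge (Fin N))
  rw [Matrix.sub_apply, lexMaxFlow, lexMaxFlow, Matrix.of_apply, Matrix.of_apply, hgm.lexMax_eq,
    hgm'.lexMax_eq, Real.norm_eq_abs]
  refine key.trans ?_
  rw [sum_edge]
  have b1 : ∀ i, |(ρ' i i).re - (ρ i i).re| ≤ ε := fun i => by
    rw [← Complex.sub_re]
    exact (Complex.abs_re_le_norm _).trans
      ((Matrix.norm_entry_le_entrywise_sup_norm (ρ' - ρ)).trans h₁)
  have b2 : ∀ j, |((U' * ρ' * U'ᴴ) j j).re - ((U * ρ * Uᴴ) j j).re| ≤ 3 * N ^ 2 * ε := fun j => by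
    rw [← Complex.sub_re]
    exact (Complex.abs_re_le_norm _).trans (norm_conj_apply_sub_le hρ hρ' hU hU' h₁ h₂ j)
  have b3 : ∀ i j, |‖U' j i‖ - ‖U j i‖| ≤ ε := fun i j =>
    (abs_norm_sub_norm_le _ _).trans ((Matrix.norm_entry_le_entrywise_sup_norm (U' - U)).trans h₂)
  -- The three sums run over the row, column and middle edges; `N ≥ 1`, because an index exists,
  -- absorbs the lower powers.
  calc _ ≤ ∑ _i : Fin N, ε + ∑ _j : Fin N, 3 * N ^ 2 * ε + ∑ _i : Fin N, ∑ _j : Fin N, ε := by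
        refine add_le_add (add_le_add (Finset.sum_le_sum fun i _ => b1 i)
          (Finset.sum_le_sum fun j _ => b2 j))
          (Finset.sum_le_sum fun i _ => Finset.sum_le_sum fun j _ => b3 i j)
    _ = (N + 3 * N ^ 3 + N ^ 2) * ε := by
        simp
        ring
    _ ≤ 5 * N ^ 3 * ε := by
        gcongr
        have h2 : (N : ℝ) ^ 1 ≤ N ^ 3 := pow_le_pow_right₀ hN (by norm_num)
        have h3 : (N : ℝ) ^ 2 ≤ N ^ 3 := pow_le_pow_right₀ hN (by norm_num)
        linarith

/-- Conjugation by a permutation matrix is reindexing, which preserves the maximum norm, mixed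
states and unitarity; so each summand obeys the bound for `lexMaxFlow`. -/
theorem joint_eq (ρ U : Matrix (Fin N) (Fin N) ℂ) : joint N ρ U =
    (1 / (Nat.factorial N : ℝ)) • ∑ σ : Equiv.Perm (Fin N),
      (lexMaxFlow (ρ.submatrix ⇑σ⁻¹ ⇑σ⁻¹) (U.submatrix ⇑σ⁻¹ ⇑σ⁻¹)).submatrix σ σ := by
  simp only [joint, Matrix.inv_permMatrix_mul_mul, Matrix.permMatrix_mul_mul_inv]

theorem norm_joint_sub_le (hρ : IsMixedState ρ) (hρ' : IsMixedState ρ')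
    (hU : U ∈ Matrix.unitaryGroup (Fin N) ℂ) (hU' : U' ∈ Matrix.unitaryGroup (Fin N) ℂ)
    (h₁ : ‖ρ' - ρ‖ ≤ ε) (h₂ : ‖U' - U‖ ≤ ε) :
    ‖joint N ρ' U' - joint N ρ U‖ ≤ 5 * N ^ 3 * ε := by
  have hN : (0 : ℝ) < Nat.factorial N := by exact_mod_cast Nat.factorial_pos N
  rw [joint_eq, joint_eq, ← smul_sub, ← Finset.sum_sub_distrib, norm_smul, Real.norm_eq_abs,
    abs_of_pos (by positivity), one_div, inv_mul_le_iff₀ hN]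
  calc _ ≤ ∑ _σ : Equiv.Perm (Fin N), 5 * N ^ 3 * ε := by
        refine (norm_sum_le _ _).trans (Finset.sum_le_sum fun σ _ => ?_)
        rw [Matrix.norm_submatrix_sub_submatrix]
        refine norm_lexMaxFlow_sub_le (hρ.submatrix σ⁻¹) (hρ'.submatrix σ⁻¹)
          (Matrix.submatrix_mem_unitaryGroup hU σ⁻¹) (Matrix.submatrix_mem_unitaryGroup hU' σ⁻¹)
          ?_ ?_
        · rwa [Matrix.norm_submatrix_sub_submatrix]
        · rwa [Matrix.norm_submatrix_sub_submatrix]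
    _ = Nat.factorial N * (5 * N ^ 3 * ε) := by
        simp [Fintype.card_perm]

theorem isRobust_joint : IsRobust joint := by
  intro p hp
  have heval : ∀ N : ℕ, (5 * Polynomial.X ^ 3 * p : Polynomial ℝ).eval (N : ℝ) =
      5 * N ^ 3 * p.eval (N : ℝ) := fun N => by simp
  -- This `q` cancels the Lipschitz constant: `5N³ / q(N) = 1 / p(N)`.
  refine ⟨5 * Polynomial.X ^ 3 * p, fun N hN => ?_, fun N hN ρ ρ' U U' hρ hρ' hU hU' h₁ h₂ => ?_⟩
  · have : (0 : ℝ) < N := by exact_mod_cast hN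
    rw [heval]
    exact mul_pos (by positivity) (hp N hN)
  · have h0 : (0 : ℝ) < N := by exact_mod_cast hN
    have hp0 := hp N hN
    refine (norm_joint_sub_le hρ hρ' hU hU' h₁ h₂).trans_eq ?_
    rw [heval]
    field_simp

end FlowTheory

end

end Quantum

theorem theorem6 :
    -- In a flow network the lexicographically maximal flow exists and is unique, and if the capacity
    -- of one edge changes, then no coordinate changes by more than that capacity did.
    (∀ (V E : Type*) [DecidableEq V] [Fintype E] [LinearOrder E] (G : FlowNetwork V E) (c : E → ℝ),
      (∀ e, 0 ≤ c e) →
      (∃! f, IsLexMax (G.flows c) f) ∧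
      ∀ (e₀ : E) (x : ℝ), 0 ≤ x → ∀ f f' : WithBot E → ℝ,
        IsLexMax (G.flows c) f → IsLexMax (G.flows (Function.update c e₀ x)) f' →
        ∀ e : WithBot E, |f' e - f e| ≤ |x - c e₀|) ∧
    -- The flow that defines the flow theory exists.
    (∀ N : ℕ, 1 ≤ N → ∀ ρ U : Matrix (Fin N) (Fin N) ℂ,
      IsMixedState ρ → U ∈ Matrix.unitaryGroup (Fin N) ℂ →
      IsLexMax (FlowTheory.maxFlows ρ U) (lexMax (FlowTheory.maxFlows ρ U))) ∧
    -- The flow theory is robust.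
    IsRobust FlowTheory.joint := by
  refine ⟨fun V E _ _ _ G c hc => ⟨G.existsUnique_isLexMax hc, fun e₀ x _ f f' hf hf' e =>
    FlowNetwork.abs_sub_le_of_update hf hf' e⟩, fun N _ ρ U hρ hU =>
    FlowTheory.isLexMax_lexMax_maxFlows hρ hU, FlowTheory.isRobust_joint⟩
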